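/- A \emph{pentagulation} is a finite simple plane graph in which every face (including the outer one) is bounded by a cycle of length $5$. For a vertex $v$ of a pentagulation $G$, let $N_2(v)$ be the set of vertices at distance exactly $2$ from $v$, and let $F_v$ be the subgraph of $G$ consisting of all vertices and edges that lie on the boundary of some face incident with $v$. For vertices $x, y \in N_2(v)$ and $k \ge 1$, a path $Q$ of length $k$ in $G$ from $x$ to $y$ is called a \emph{$k$-chord with respect to $v$} if no vertex of $Q$ other than $x$ and $y$ belongs to $N_2(v)$ and no edge of $Q$ belongs to $F_v$. In particular, a $1$-chord with respect to $v$ is an edge of $G$ that joins two vertices of $N_2(v)$ and does not lie on the boundary of any face incident with $v$. \textbf{Theorem.} Let $G$ be a pentagulation of diameter $3$, girth $5$ and maximum degree $\Delta$, and let $v$ be a vertex of $G$ with $\deg(v) = \Delta$. If $\Delta \geq 8$, then there is no $1$-chord with respect to $v$. -/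

import Mathlib

/-- A rotation system on a simple graph: at every vertex, a cyclic ordering of the darts (oriented
edges) leaving that vertex.  `rot d` is the dart following `d` in the cyclic ordering around the
initial vertex `d.fst`. -/
structure RotationSystem {V : Type*} (G : SimpleGraph V) where
  /-- The permutation of the darts giving the successor in the cyclic order. -/
  rot : Equiv.Perm G.Dart
  /-- The rotation turns around the initial vertex of a dart. -/
  rot_fst : ∀ d : G.Dart, (rot d).fst = d.fst
  /-- The darts leaving a given vertex form one single cycle of the rotation. -/
  sameCycle : ∀ d e : G.Dart, d.fst = e.fst → rot.SameCycle d e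

namespace RotationSystem

variable {V : Type*} {G : SimpleGraph V} (M : RotationSystem G)

/-- The face permutation: walking along the boundary of a face, the dart from `a` to `b` is followed
by the successor, in the cyclic order at `b`, of the dart from `b` to `a`. -/
def facePerm : Equiv.Perm G.Dart :=
  (SimpleGraph.Dart.symm_involutive (G := G)).toPerm.trans M.rot

/-- The faces of the embedding: the cycles (orbits) of the face permutation.  (This is the set of
faces of every connected graph that has at least one edge.) -/
def Face : Type _ := Quotient (Equiv.Perm.SameCycle.setoid M.facePerm)

/-- The face whose boundary walk traverses the dart `d`. -/
def faceOf (d : G.Dart) : M.Face := Quotient.mk _ d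

/-- The vertex `w` lies on the boundary of the face `f`, i.e. `f` and `w` are incident. -/
def VertexOnFace (f : M.Face) (w : V) : Prop :=
  ∃ d : G.Dart, M.faceOf d = f ∧ d.fst = w

/-- The edge `e` lies on the boundary of the face `f`. -/
def EdgeOnFace (f : M.Face) (e : Sym2 V) : Prop :=
  ∃ d : G.Dart, M.faceOf d = f ∧ d.edge = e

/-- The face `f` is bounded by a cycle of length `k`: its boundary walk is a cycle of `G` of
length `k`. -/
def IsBoundedByCycle (f : M.Face) (k : ℕ) : Prop :=
  ∃ (u : V) (c : G.Walk u u), c.IsCycle ∧ c.length = k ∧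
    ∀ d : G.Dart, d ∈ c.darts ↔ M.faceOf d = f

/-- The Euler characteristic of the closed orientable surface obtained by gluing a disc along
every boundary walk. -/
noncomputable def eulerChar : ℤ :=
  (Nat.card V : ℤ) - (Nat.card G.edgeSet : ℤ) + (Nat.card M.Face : ℤ)

/-- The rotation system describes a connected plane graph (with at least one edge): the graph is
connected and the surface carrying it is the sphere, i.e. it has genus `0`.  Rotation systems of
genus `0` are the embeddings of connected graphs in the sphere up to orientation-preserving
homeomorphism; the choice of the outer face is immaterial below. -/
def IsPlane : Prop :=
  G.Connected ∧ M.eulerChar = 2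

/-- A pentagulation: a plane graph in which every face is bounded by a cycle of length 5. -/
def IsPentagulation : Prop :=
  M.IsPlane ∧ ∀ f : M.Face, M.IsBoundedByCycle f 5

/-- The subgraph of `G` consisting of the edges and vertices that lie on the boundary of any face
incident with `v`. -/
def facesAround (v : V) : G.Subgraph where
  verts := {w | ∃ f : M.Face, M.VertexOnFace f v ∧ M.VertexOnFace f w}
  Adj a b := ∃ f : M.Face, M.VertexOnFace f v ∧ M.EdgeOnFace f s(a, b)
  adj_sub := by
    rintro a b ⟨f, -, d, -, hd⟩
    have h := d.edge_mem
    rw [hd] at h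
    exact h
  edge_vert := by
    rintro a b ⟨f, hf, d, rfl, hd⟩
    refine ⟨_, hf, ?_⟩
    rcases d with ⟨⟨x, y⟩, hxy⟩
    rcases Sym2.eq_iff.mp hd with ⟨h, -⟩ | ⟨-, h⟩
    · exact ⟨_, rfl, h⟩
    · refine ⟨M.facePerm ⟨(x, y), hxy⟩, ?_, ?_⟩
      · exact Quotient.sound (Equiv.Perm.sameCycle_apply_left.mpr (Equiv.Perm.SameCycle.refl _ _))
      · exact (M.rot_fst _).trans h
  symm := ⟨by
    rintro a b ⟨f, hf, he⟩
    exact ⟨f, hf, by rwa [Sym2.eq_swap]⟩⟩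

end RotationSystem

/-- `N_i(v)`, the set of vertices at distance `i` from `v` (in a connected graph). -/
def distSphere {V : Type*} (G : SimpleGraph V) (i : ℕ) (v : V) : Set V :=
  {w | G.dist v w = i}

/-- The `x`-`y` walk `Q` is a `k`-chord with respect to `v`: `x` and `y` belong to `N_2(v)`, `Q` is
a path of length `k`, no vertex of `Q` other than `x` and `y` belongs to `N_2(v)`, and no edge of
`Q` lies on the boundary of a face incident with `v`. -/
def RotationSystem.IsChord {V : Type*} {G : SimpleGraph V} (M : RotationSystem G) (v : V) (k : ℕ)
    {x y : V} (Q : G.Walk x y) : Prop :=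
  x ∈ distSphere G 2 v ∧ y ∈ distSphere G 2 v ∧ Q.IsPath ∧ Q.length = k ∧
    (∀ z ∈ Q.support, z ≠ x → z ≠ y → z ∉ distSphere G 2 v) ∧
    (∀ e ∈ Q.edges, e ∉ (M.facesAround v).edgeSet)

/-! Let `n = Δ` and let `u 0, …, u (n - 1)` be the neighbours of `v` in cyclic order (the spokes).
By girth 5, a vertex at distance 2 from `v` has exactly one of them as a neighbour, its parent. A
chord `xy` with parents `u 0` and `u m` closes a 5-cycle `C = v, u 0, x, y, u m`, which separates
the plane. As the diameter is 3, two vertices strictly on different sides of `C` cannot both lack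
neighbours on `C`. Two consecutive spokes off `C` have adjacent children, one of which has no
neighbour on `C`. Hence some side of `C` contains at most one spoke (`le_two_or_of_chord`).

That small side still contains a vertex attached to `C` only at some `c ∈ {x, u 0}` and one attached
only at some `c' ∈ {y, u m}`. So every child on the large side that is adjacent to neither `x` nor
`y` is joined to both `c` and `c'` by paths of length 2 (`exists_ends_of_chord`). For one such child
`z` of `u k`, these paths give two more closed walks through `v`. They force all children of spokes
between `u m` and `u k` to be adjacent to `y`, and all children of spokes after `u k` to be adjacent
to `x` (`adj_of_separation`). Since `n ≥ 8`, one of the two ranges contains consecutive spokes,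
whose adjacent children then close a triangle.

Planarity enters only through `exists_face_coloring`: Euler characteristic 2 makes every cycle
modulo 2 the boundary of a set of faces. -/

namespace RotationSystem

variable {V : Type*} {G : SimpleGraph V} (M : RotationSystem G)

/-! ### Homology modulo 2 and the discrete Jordan curve theorem -/

theorem faceOf_facePerm (d : G.Dart) : M.faceOf (M.facePerm d) = M.faceOf d :=
  Quotient.sound (Equiv.Perm.sameCycle_apply_left.mpr (Equiv.Perm.SameCycle.refl _ _))

theorem facePerm_symm (d : G.Dart) : M.facePerm d.symm = M.rot d := by
  change M.rot d.symm.symm = M.rot d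
  rw [SimpleGraph.Dart.symm_symm]

theorem faceOf_rot (d : G.Dart) : M.faceOf (M.rot d) = M.faceOf d.symm := by
  rw [← M.facePerm_symm, M.faceOf_facePerm]

theorem rot_pow_fst (d : G.Dart) (k : ℕ) : ((M.rot ^ k) d).fst = d.fst := by
  induction k with
  | zero => rfl
  | succ k ih => rw [pow_succ', Equiv.Perm.mul_apply, M.rot_fst, ih]

theorem rot_pow_succ (d : G.Dart) (k : ℕ) : (M.rot ^ (k + 1)) d = M.rot ((M.rot ^ k) d) := by
  rw [pow_succ', Equiv.Perm.mul_apply]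

theorem eq_of_rot_invariant {α : Type*} (f : G.Dart → α) (v : V)
    (hf : ∀ d : G.Dart, d.fst = v → f (M.rot d) = f d) (d e : G.Dart) (hd : d.fst = v)
    (he : e.fst = v) : f d = f e := by
  have key (n : ℕ) (d : G.Dart) (hd : d.fst = v) : f ((M.rot ^ n) d) = f d := by
    induction n with
    | zero => rfl
    | succ n ih => rw [rot_pow_succ, hf _ ((M.rot_pow_fst d n).trans hd), ih]
  obtain ⟨i, hi⟩ := M.sameCycle d e (hd.trans he.symm)
  rcases i with n | n
  · rw [← hi]
    simpa using (key n d hd).symm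
  · rw [← key (n + 1) e he, ← hi, ← zpow_natCast, ← Equiv.Perm.mul_apply, ← zpow_add]
    have h0 : ((n + 1 : ℕ) : ℤ) + Int.negSucc n = 0 := by omega
    rw [h0]; rfl

/-- Every edge has an orientation. -/
theorem exists_dart_edge (e : G.edgeSet) : ∃ d : G.Dart, d.edge = e := by
  obtain ⟨e, he⟩ := e
  induction e with
  | h a b => exact ⟨⟨(a, b), he⟩, rfl⟩

/-- An arbitrary orientation of an edge. -/
noncomputable def orient (e : G.edgeSet) : G.Dart := (exists_dart_edge e).choose

theorem edge_orient (e : G.edgeSet) : (orient e).edge = e := (exists_dart_edge e).choose_spec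

theorem orient_edge (d : G.Dart) :
    orient ⟨d.edge, d.edge_mem⟩ = d ∨ orient ⟨d.edge, d.edge_mem⟩ = d.symm :=
  SimpleGraph.dart_edge_eq_iff _ _ |>.mp (edge_orient _)

/-- The boundary, modulo 2, of a set of faces. -/
noncomputable def faceBoundary : (M.Face → ZMod 2) →ₗ[ZMod 2] (G.edgeSet → ZMod 2) where
  toFun φ e := φ (M.faceOf (orient e)) + φ (M.faceOf (orient e).symm)
  map_add' φ φ' := by ext e; simp only [Pi.add_apply]; ring
  map_smul' c φ := by ext e; simp only [Pi.smul_apply, smul_eq_mul, RingHom.id_apply]; ring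

theorem faceBoundary_edge (φ : M.Face → ZMod 2) (d : G.Dart) :
    M.faceBoundary φ ⟨d.edge, d.edge_mem⟩ = φ (M.faceOf d) + φ (M.faceOf d.symm) := by
  rcases orient_edge d with h | h <;> simp [faceBoundary, h, add_comm]

/-- The coboundary, modulo 2, of a set of vertices. -/
noncomputable def vertexCoboundary (G : SimpleGraph V) :
    (V → ZMod 2) →ₗ[ZMod 2] (G.edgeSet → ZMod 2) where
  toFun f e := f (orient e).fst + f (orient e).snd
  map_add' φ φ' := by ext e; simp only [Pi.add_apply]; ring
  map_smul' c φ := by ext e; simp only [Pi.smul_apply, smul_eq_mul, RingHom.id_apply]; ring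

theorem vertexCoboundary_edge (f : V → ZMod 2) (d : G.Dart) :
    vertexCoboundary G f ⟨d.edge, d.edge_mem⟩ = f d.fst + f d.snd := by
  rcases orient_edge d with h | h <;> simp [vertexCoboundary, h, add_comm]

theorem _root_.SimpleGraph.Connected.eq_of_forall_adj {α : Type*} (hG : G.Connected) (f : V → α)
    (hf : ∀ a b, G.Adj a b → f a = f b) (a b : V) : f a = f b := by
  obtain ⟨p⟩ := hG.preconnected a b
  induction p with
  | nil => rfl
  | cons h p ih => exact (hf _ _ h).trans ih

theorem eq_of_add_eq_zero {a b : ZMod 2} (h : a + b = 0) : a = b := by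
  revert a b; decide

theorem finrank_le_one_of_const {X : Type*} [Finite X] (W : Submodule (ZMod 2) (X → ZMod 2))
    (hW : ∀ f ∈ W, ∀ a b, f a = f b) : Module.finrank (ZMod 2) W ≤ 1 := by
  by_cases hX : Nonempty X
  · obtain ⟨a⟩ := hX
    have hle : W ≤ Submodule.span (ZMod 2) {fun _ : X => (1 : ZMod 2)} := by
      intro f hf
      rw [Submodule.mem_span_singleton]
      exact ⟨f a, by ext b; simp [hW f hf a b]⟩
    exact (Submodule.finrank_mono hle).trans ((finrank_span_le_card _).trans (by simp))
  · rw [not_nonempty_iff] at hX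
    have : Subsingleton W := inferInstance
    rw [Module.finrank_zero_of_subsingleton]; exact zero_le_one

/-- A colouring with zero boundary does not change across an edge, hence not when turning around a
vertex. It therefore descends to a function on vertices, which is constant by connectedness. -/
theorem faceBoundary_ker_const (hG : G.Connected) (φ : M.Face → ZMod 2)
    (hφ : M.faceBoundary φ = 0) (a b : M.Face) : φ a = φ b := by
  have hs (d : G.Dart) : φ (M.faceOf d) = φ (M.faceOf d.symm) := by
    apply eq_of_add_eq_zero
    rw [← M.faceBoundary_edge, hφ]; rfl
  have hr (d : G.Dart) : φ (M.faceOf (M.rot d)) = φ (M.faceOf d) := by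
    rw [M.faceOf_rot, ← hs]
  have hv (d e : G.Dart) (h : d.fst = e.fst) : φ (M.faceOf d) = φ (M.faceOf e) :=
    M.eq_of_rot_invariant (fun d => φ (M.faceOf d)) e.fst (fun d _ => hr d) d e h rfl
  induction a using Quotient.ind with | _ d => ?_
  induction b using Quotient.ind with | _ e => ?_
  change φ (M.faceOf d) = φ (M.faceOf e)
  classical
  -- The default value 0 is harmless: `g` is evaluated only at vertices that are the origin of a
  -- dart.
  let g : V → ZMod 2 := fun w => if h : ∃ d : G.Dart, d.fst = w then φ (M.faceOf h.choose) else 0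
  have hg (d : G.Dart) : g d.fst = φ (M.faceOf d) := by
    have h : ∃ d' : G.Dart, d'.fst = d.fst := ⟨d, rfl⟩
    simp only [g, dif_pos h]
    exact hv _ _ h.choose_spec
  rw [← hg, ← hg]
  refine hG.eq_of_forall_adj g (fun a b h => ?_) _ _
  have h1 := hg ⟨(a, b), h⟩
  have h2 := hg ⟨(b, a), h.symm⟩
  exact h1.trans ((hs _).trans h2.symm)

theorem sum_darts [Fintype G.Dart] [Fintype G.edgeSet] {A : Type*} [AddCommMonoid A]
    (g : G.Dart → A) : ∑ d, g d = ∑ e : G.edgeSet, (g (orient e) + g (orient e).symm) := by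
  classical
  rw [← Finset.sum_fiberwise (s := Finset.univ)
    (g := fun d : G.Dart => (⟨d.edge, d.edge_mem⟩ : G.edgeSet))]
  refine Finset.sum_congr rfl fun e _ => ?_
  have : Finset.univ.filter (fun d : G.Dart => (⟨d.edge, d.edge_mem⟩ : G.edgeSet) = e) =
      {orient e, (orient e).symm} := by
    ext d
    simp only [Finset.mem_filter, Finset.mem_univ, true_and, Finset.mem_insert,
      Finset.mem_singleton, Subtype.ext_iff]
    rw [← edge_orient e, SimpleGraph.dart_edge_eq_iff]
  rw [this, Finset.sum_pair (SimpleGraph.Dart.symm_ne _).symm]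

/-- Summing over darts, the faces of `d.symm` and of `rot d` coincide and `rot` fixes the initial
vertex, so the two halves of the sum agree and cancel modulo 2. -/
theorem vertexCoboundary_dotProduct_faceBoundary [Fintype G.Dart] [Fintype G.edgeSet]
    (f : V → ZMod 2) (φ : M.Face → ZMod 2) :
    vertexCoboundary G f ⬝ᵥ M.faceBoundary φ = 0 := by
  have h1 : vertexCoboundary G f ⬝ᵥ M.faceBoundary φ =
      ∑ d : G.Dart, f d.fst * (φ (M.faceOf d) + φ (M.faceOf d.symm)) := by
    rw [sum_darts, dotProduct]
    refine Finset.sum_congr rfl fun e _ => ?_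
    simp only [vertexCoboundary, faceBoundary, LinearMap.coe_mk, AddHom.coe_mk,
      SimpleGraph.Dart.symm_symm]
    change _ = _ + f (orient e).snd * _
    ring
  have h2 : ∑ d : G.Dart, f d.fst * φ (M.faceOf d.symm) =
      ∑ d : G.Dart, f d.fst * φ (M.faceOf d) := by
    rw [← Equiv.sum_comp M.rot (fun d => f d.fst * φ (M.faceOf d))]
    exact Finset.sum_congr rfl fun d _ => by rw [M.faceOf_rot, M.rot_fst]
  rw [h1]
  simp only [mul_add, Finset.sum_add_distrib]
  rw [h2]
  exact CharTwo.add_self_eq_zero _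

open Classical in
/-- The edges of a walk, counted modulo 2. -/
noncomputable def walkChain {a b : V} (p : G.Walk a b) (e : G.edgeSet) : ZMod 2 :=
  (p.edges.count e.1 : ℕ)

theorem vertexCoboundary_dotProduct_walkChain [Fintype G.edgeSet] (f : V → ZMod 2) {a b : V}
    (p : G.Walk a b) : vertexCoboundary G f ⬝ᵥ walkChain p = f a + f b := by
  classical
  induction p with
  | nil => simp [dotProduct, walkChain, CharTwo.add_self_eq_zero]
  | @cons a b c h p ih =>
    have : walkChain (SimpleGraph.Walk.cons h p) =
        walkChain p + Pi.single ⟨s(a, b), h⟩ 1 := by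
      ext e
      by_cases he : s(a, b) = e.1
      · have : e = ⟨s(a, b), h⟩ := Subtype.ext he.symm
        subst this
        simp [walkChain]
      · have : e ≠ ⟨s(a, b), h⟩ := fun h' => he (by rw [h'])
        simp [walkChain, he, Pi.single_eq_of_ne this]
    rw [this, dotProduct_add, ih, dotProduct_single, mul_one]
    have := vertexCoboundary_edge f ⟨(a, b), h⟩
    change vertexCoboundary G f ⟨s(a, b), h⟩ = f a + f b at this
    rw [this]
    have h2 := CharTwo.add_self_eq_zero (f b)
    linear_combination h2

/-- The discrete Jordan curve theorem: in a plane graph the faces can be coloured with two colours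
such that exactly the edges of a given closed walk separate faces of different colours. -/
theorem exists_face_coloring [Finite V] (hM : M.IsPlane) {a : V} (p : G.Walk a a) :
    ∃ φ : M.Face → ZMod 2, ∀ d : G.Dart,
      φ (M.faceOf d) + φ (M.faceOf d.symm) = walkChain p ⟨d.edge, d.edge_mem⟩ := by
  classical
  have := Fintype.ofFinite V
  have : Fintype G.Dart := inferInstance
  have : Finite M.Face := Quotient.finite _
  have := Fintype.ofFinite M.Face
  obtain ⟨hG, hχ⟩ := hM
  -- The kernel of the transpose of `A` is the cycle space; its dimension follows from equality of
  -- row and column rank.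
  let A := LinearMap.toMatrix' (vertexCoboundary G)
  have hA (f : V → ZMod 2) : A.mulVec f = vertexCoboundary G f := by
    rw [← Matrix.toLin'_apply, Matrix.toLin'_toMatrix']
  have hker (h : G.edgeSet → ZMod 2) :
      h ∈ A.transpose.mulVecLin.ker ↔ ∀ f, vertexCoboundary G f ⬝ᵥ h = 0 := by
    simp only [LinearMap.mem_ker, Matrix.mulVecLin_apply, ← hA]
    constructor
    · intro h0 f
      rw [dotProduct_comm, Matrix.dotProduct_mulVec, ← Matrix.mulVec_transpose, h0,
        zero_dotProduct]
    · intro h0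
      rw [← dotProduct_eq_zero_iff]
      intro f
      rw [Matrix.mulVec_transpose, ← Matrix.dotProduct_mulVec, dotProduct_comm, h0]
  have hle : M.faceBoundary.range ≤ A.transpose.mulVecLin.ker := by
    rintro _ ⟨φ, rfl⟩
    exact (hker _).mpr fun f => M.vertexCoboundary_dotProduct_faceBoundary f φ
  have r1 := M.faceBoundary.finrank_range_add_finrank_ker
  have k1 : Module.finrank (ZMod 2) M.faceBoundary.ker ≤ 1 :=
    finrank_le_one_of_const _ fun φ hφ => M.faceBoundary_ker_const hG φ hφ
  have r2 := A.transpose.mulVecLin.finrank_range_add_finrank_ker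
  have r3 := (vertexCoboundary G).finrank_range_add_finrank_ker
  have k3 : Module.finrank (ZMod 2) (vertexCoboundary G).ker ≤ 1 := by
    refine finrank_le_one_of_const _ fun f hf => hG.eq_of_forall_adj f fun a b h => ?_
    apply eq_of_add_eq_zero
    have := vertexCoboundary_edge f ⟨(a, b), h⟩
    rw [LinearMap.mem_ker.mp hf] at this
    exact this.symm
  have hr : Module.finrank (ZMod 2) A.transpose.mulVecLin.range =
      Module.finrank (ZMod 2) (vertexCoboundary G).range := by
    change A.transpose.rank = _
    rw [Matrix.rank_transpose]
    change Module.finrank (ZMod 2) A.mulVecLin.range = _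
    have hAV : A.mulVecLin = vertexCoboundary G := LinearMap.ext hA
    rw [hAV]
  -- Boundaries have dimension at least `F - 1` and cycles at most `E - (V - 1)`. Euler's formula
  -- makes these bounds equal.
  have heq : M.faceBoundary.range = A.transpose.mulVecLin.ker := by
    apply Submodule.eq_of_le_of_finrank_le hle
    simp only [Module.finrank_fintype_fun_eq_card] at r1 r2 r3
    simp only [eulerChar, Nat.card_eq_fintype_card] at hχ
    omega
  have hp : walkChain p ∈ M.faceBoundary.range := by
    rw [heq, hker]
    intro f
    rw [vertexCoboundary_dotProduct_walkChain]
    exact CharTwo.add_self_eq_zero _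
  obtain ⟨φ, hφ⟩ := hp
  exact ⟨φ, fun d => by rw [← hφ, M.faceBoundary_edge]⟩

end RotationSystem

/-! ### Spokes, pentagonal corners and separation at a vertex -/

namespace RotationSystem

variable {V : Type*} {G : SimpleGraph V} (M : RotationSystem G)

theorem isCycleOn_rot [Fintype V] [DecidableEq V] [DecidableRel G.Adj] (v : V) :
    M.rot.IsCycleOn (Finset.univ.filter fun d : G.Dart => d.fst = v : Finset G.Dart) := by
  refine ⟨⟨fun d hd => ?_, M.rot.injective.injOn, fun d hd => ⟨M.rot.symm d, ?_, by simp⟩⟩,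
    fun d hd e he => ?_⟩
  · simpa [M.rot_fst] using hd
  · have := M.rot_fst (M.rot.symm d)
    rw [Equiv.apply_symm_apply] at this
    simpa [← this] using hd
  · simp only [Finset.coe_filter, Finset.mem_univ, true_and, Set.mem_ofPred_eq] at hd he
    exact M.sameCycle d e (hd.trans he.symm)

theorem dart_ext {d e : G.Dart} (h1 : d.fst = e.fst) (h2 : d.snd = e.snd) : d = e :=
  SimpleGraph.Dart.ext _ _ (Prod.ext h1 h2)

theorem adj_rot_pow_snd (d : G.Dart) (k : ℕ) : G.Adj d.fst ((M.rot ^ k) d).snd := by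
  have := ((M.rot ^ k) d).adj
  rwa [M.rot_pow_fst] at this

section Spokes

variable [Fintype V] [DecidableRel G.Adj] (d : G.Dart)

theorem rot_pow_snd_inj {k l : ℕ} (hk : k < G.degree d.fst) (hl : l < G.degree d.fst)
    (h : ((M.rot ^ k) d).snd = ((M.rot ^ l) d).snd) : k = l := by
  classical
  have h1 := dart_ext ((M.rot_pow_fst d k).trans (M.rot_pow_fst d l).symm) h
  rw [(M.isCycleOn_rot d.fst).pow_apply_eq_pow_apply (by simp),
    G.dart_fst_fiber_card_eq_degree] at h1
  exact Nat.ModEq.eq_of_lt_of_lt h1 hk hl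

theorem exists_rot_pow_snd {w : V} (h : G.Adj d.fst w) :
    ∃ k < G.degree d.fst, ((M.rot ^ k) d).snd = w := by
  classical
  obtain ⟨k, hk, h'⟩ := (M.isCycleOn_rot d.fst).exists_pow_eq (a := d) (b := ⟨(d.fst, w), h⟩)
    (by simp) (by simp)
  rw [G.dart_fst_fiber_card_eq_degree] at hk
  exact ⟨k, hk, by rw [h']⟩

theorem rot_pow_degree : (M.rot ^ G.degree d.fst) d = d := by
  classical
  have := (M.isCycleOn_rot d.fst).pow_card_apply (a := d) (by simp)
  rwa [G.dart_fst_fiber_card_eq_degree] at this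

end Spokes

theorem facePerm_fst (d : G.Dart) : (M.facePerm d).fst = d.snd := M.rot_fst d.symm

/-- A cycle repeats no dart, so the orbit of `d` under `facePerm` has exactly `k` elements. -/
theorem facePerm_pow_eq {d : G.Dart} {k : ℕ} (h : M.IsBoundedByCycle (M.faceOf d) k) :
    (M.facePerm ^ k) d = d := by
  classical
  obtain ⟨u, c, hc, rfl, hd⟩ := h
  have hmem (e : G.Dart) : e ∈ c.darts.toFinset ↔ M.faceOf e = M.faceOf d := by
    rw [List.mem_toFinset, hd]
  have hcyc : M.facePerm.IsCycleOn (c.darts.toFinset : Finset G.Dart) := by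
    refine ⟨⟨fun e he => ?_, M.facePerm.injective.injOn,
      fun e he => ⟨M.facePerm.symm e, ?_, by simp⟩⟩, fun e he e' he' => ?_⟩
    · rw [Finset.mem_coe, hmem] at he ⊢
      rwa [M.faceOf_facePerm]
    · rw [Finset.mem_coe, hmem] at he ⊢
      rwa [← M.faceOf_facePerm, Equiv.apply_symm_apply]
    · rw [Finset.mem_coe, hmem] at he he'
      exact Quotient.exact (he.trans he'.symm)
  have := hcyc.pow_card_apply (a := d) ((hmem d).mpr rfl)
  rwa [List.toFinset_card_of_nodup (List.Nodup.of_map _ hc.isTrail.edges_nodup), c.length_darts] at this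

/-- The face of a pentagulation between two consecutive spokes. -/
theorem exists_pentagon (hM : ∀ f : M.Face, M.IsBoundedByCycle f 5) (d : G.Dart) :
    ∃ a b : V, G.Adj d.snd a ∧ G.Adj a b ∧ G.Adj b (M.rot d).snd ∧
      M.VertexOnFace (M.faceOf (M.rot d)) a ∧ M.VertexOnFace (M.faceOf (M.rot d)) b ∧
      (M.facesAround d.fst).Adj a b := by
  have h5 := M.facePerm_pow_eq (hM (M.faceOf (M.rot d)))
  simp only [pow_succ', pow_zero, mul_one, Equiv.Perm.mul_apply] at h5
  set e₀ := M.rot d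
  set e₁ := M.facePerm e₀ with he₁
  set e₂ := M.facePerm e₁ with he₂
  set e₃ := M.facePerm e₂ with he₃
  set e₄ := M.facePerm e₃ with he₄
  -- The face walk starting at `rot d` closes after five steps, and `d.symm` is the predecessor of
  -- `rot d` in it.
  have h4 : e₄ = d.symm := by
    apply M.facePerm.injective
    rw [h5, M.facePerm_symm]
  have f1 : M.faceOf e₁ = M.faceOf e₀ := M.faceOf_facePerm _
  have f2 : M.faceOf e₂ = M.faceOf e₀ := (M.faceOf_facePerm _).trans f1
  have f3 : M.faceOf e₃ = M.faceOf e₀ := (M.faceOf_facePerm _).trans f2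
  have w1 : e₁.fst = e₀.snd := M.facePerm_fst _
  have w2 : e₂.fst = e₁.snd := M.facePerm_fst _
  have w3 : e₃.fst = e₂.snd := M.facePerm_fst _
  have w4 : e₄.fst = e₃.snd := M.facePerm_fst _
  have w4' : e₄.fst = d.snd := by rw [h4]; rfl
  refine ⟨e₃.fst, e₂.fst, ?_, ?_, ?_, ⟨e₃, f3, rfl⟩, ⟨e₂, f2, rfl⟩,
    M.faceOf e₀, ⟨e₀, rfl, M.rot_fst d⟩, e₂, f2, ?_⟩
  · rw [← w4', w4]; exact e₃.adj.symm
  · rw [w3]; exact e₂.adj.symm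
  · rw [w2, ← w1]; exact e₁.adj.symm
  · rw [w3, Sym2.eq_swap]; rfl

theorem vertexOnFace_rot_snd (d : G.Dart) : M.VertexOnFace (M.faceOf (M.rot d)) d.snd :=
  ⟨d.symm, (M.faceOf_rot d).symm, rfl⟩

/-- A walk joining two neighbours of a vertex `v` and avoiding `v` separates the two sides of the
closed walk through `v` that it determines. -/
theorem exists_separation [Fintype V] [DecidableRel G.Adj] (hM : M.IsPlane) (d : G.Dart)
    {i j : ℕ} (hij : i < j) (hj : j < G.degree d.fst)
    (P : G.Walk ((M.rot ^ i) d).snd ((M.rot ^ j) d).snd) (hP : d.fst ∉ P.support) :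
    ∃ ψ : V → Prop,
      (∀ a b, a ≠ d.fst → b ≠ d.fst → a ∉ P.support → b ∉ P.support → G.Adj a b →
        (ψ a ↔ ψ b)) ∧
      (∀ k w, i ≤ k → k < j → M.VertexOnFace (M.faceOf ((M.rot ^ (k + 1)) d)) w → w ≠ d.fst →
        w ∉ P.support → ψ w) ∧
      (∀ k w, k < G.degree d.fst → (k < i ∨ j ≤ k) →
        M.VertexOnFace (M.faceOf ((M.rot ^ (k + 1)) d)) w → w ≠ d.fst → w ∉ P.support →
        ¬ ψ w) := by
  classical
  have hi := M.adj_rot_pow_snd d i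
  have hj' := (M.adj_rot_pow_snd d j).symm
  obtain ⟨φ, hφ⟩ := M.exists_face_coloring hM (SimpleGraph.Walk.cons hi (P.concat hj'))
  have hoff (e : G.Dart) (h1 : e.fst ≠ d.fst) (h2 : e.fst ∉ P.support) :
      φ (M.faceOf e) = φ (M.faceOf e.symm) := by
    apply eq_of_add_eq_zero
    rw [hφ]
    have h0 : e.edge ∉ (SimpleGraph.Walk.cons hi (P.concat hj')).edges := by
      intro h
      have := SimpleGraph.Walk.fst_mem_support_of_mem_edges _ (t := e.fst) (u := e.snd) h
      simp [SimpleGraph.Walk.support_concat, h1, h2] at this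
    simp only [walkChain]
    rw [List.count_eq_zero_of_not_mem h0]
    rfl
  have hconst (e e' : G.Dart) (h : e.fst = e'.fst) (h1 : e'.fst ≠ d.fst)
      (h2 : e'.fst ∉ P.support) : φ (M.faceOf e) = φ (M.faceOf e') := by
    refine M.eq_of_rot_invariant (fun e => φ (M.faceOf e)) e'.fst (fun e he => ?_) e e' h rfl
    rw [M.faceOf_rot, ← hoff e (by rwa [he]) (by rwa [he])]
  -- `c k` is the colour of the corner just before spoke `k`, so the corner between spokes `k` and
  -- `k + 1` has colour `c (k + 1)`. The colour flips exactly at spokes `i` and `j`.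
  let c (k : ℕ) : ZMod 2 := φ (M.faceOf ((M.rot ^ k) d))
  have hc (k : ℕ) (hk : k < G.degree d.fst) :
      c (k + 1) = c k + ((if k = i then 1 else 0) + (if k = j then 1 else 0)) := by
    have h1 := hφ ((M.rot ^ k) d)
    have h2 : c (k + 1) = φ (M.faceOf ((M.rot ^ k) d).symm) := by
      simp only [c, rot_pow_succ, faceOf_rot]
    have he : ((M.rot ^ k) d).edge = s(d.fst, ((M.rot ^ k) d).snd) := by
      conv_lhs => rw [show ((M.rot ^ k) d) = ⟨(d.fst, ((M.rot ^ k) d).snd),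
        M.adj_rot_pow_snd d k⟩ from dart_ext (M.rot_pow_fst d k) rfl]
      rfl
    have hP' : s(d.fst, ((M.rot ^ k) d).snd) ∉ P.edges := fun h =>
      hP (SimpleGraph.Walk.fst_mem_support_of_mem_edges _ h)
    have hcount : (walkChain (SimpleGraph.Walk.cons hi (P.concat hj'))
        ⟨((M.rot ^ k) d).edge, ((M.rot ^ k) d).edge_mem⟩) =
        (if k = i then 1 else 0) + (if k = j then 1 else 0) := by
      have hki : ((M.rot ^ k) d).snd = ((M.rot ^ i) d).snd ↔ k = i :=
        ⟨M.rot_pow_snd_inj d hk (hij.trans hj), fun h => by rw [h]⟩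
      have hkj : ((M.rot ^ k) d).snd = ((M.rot ^ j) d).snd ↔ k = j :=
        ⟨M.rot_pow_snd_inj d hk hj, fun h => by rw [h]⟩
      have ei : s(d.fst, ((M.rot ^ i) d).snd) = s(d.fst, ((M.rot ^ k) d).snd) ↔ k = i := by
        rw [← hki, Sym2.congr_right, eq_comm]
      have ej : s(((M.rot ^ j) d).snd, d.fst) = s(d.fst, ((M.rot ^ k) d).snd) ↔ k = j := by
        rw [← hkj, Sym2.eq_swap, Sym2.congr_right, eq_comm]
      simp only [walkChain, SimpleGraph.Walk.edges_cons, SimpleGraph.Walk.edges_concat, he,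
        List.count_cons, List.concat_eq_append, List.count_append,
        List.count_eq_zero_of_not_mem hP', List.count_nil, beq_iff_eq, ei, ej]
      push_cast
      ring
    rw [hcount] at h1
    rw [h2, ← h1]
    have := CharTwo.add_self_eq_zero (c k)
    change _ = c k + (c k + _)
    linear_combination -this
  have hmid (k : ℕ) (h1 : i < k) (h2 : k ≤ j) : c k = c i + 1 := by
    induction k, h1 using Nat.le_induction with
    | base => rw [hc i (hij.trans hj)]; simp [hij.ne]
    | succ k hk ih =>
      rw [hc k (by omega), ih (by omega), if_neg (by omega), if_neg (by omega)]; ring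
  have hlow (k : ℕ) (h1 : k ≤ i) : c k = c 0 := by
    induction k with
    | zero => rfl
    | succ k ih =>
      rw [hc k (by omega), ih (by omega), if_neg (by omega), if_neg (by omega)]; ring
  have hhigh (k : ℕ) (h1 : j < k) (h2 : k ≤ G.degree d.fst) : c k = c i := by
    induction k, h1 using Nat.le_induction with
    | base =>
      rw [hc j hj, hmid j hij le_rfl, if_neg hij.ne', if_pos rfl]
      have := CharTwo.add_self_eq_zero (1 : ZMod 2)
      linear_combination this
    | succ k hk ih =>
      rw [hc k (by omega), ih (by omega), if_neg (by omega), if_neg (by omega)]; ring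
  have hne : c i ≠ c i + 1 := by
    generalize c i = z; revert z; decide
  -- Off the closed walk all darts leaving `w` see the same colour, so one dart decides the side of
  -- `w`.
  refine ⟨fun w => ∃ e : G.Dart, e.fst = w ∧ φ (M.faceOf e) = c i + 1, ?_, ?_, ?_⟩
  · have key (a b : V) (ha : a ≠ d.fst) (ha' : a ∉ P.support) (h : G.Adj a b) :
        (∃ e : G.Dart, e.fst = a ∧ φ (M.faceOf e) = c i + 1) →
        ∃ e : G.Dart, e.fst = b ∧ φ (M.faceOf e) = c i + 1 := by
      rintro ⟨e, he, h'⟩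
      refine ⟨⟨(b, a), h.symm⟩, rfl, ?_⟩
      rw [← h', hconst e ⟨(a, b), h⟩ he ha ha', hoff ⟨(a, b), h⟩ ha ha']
      rfl
    exact fun a b ha hb ha' hb' h => ⟨key a b ha ha' h, key b a hb hb' h.symm⟩
  · rintro k _ h1 h2 ⟨e, he, rfl⟩ h3 h4
    exact ⟨e, rfl, by rw [he]; exact hmid (k + 1) (by omega) (by omega)⟩
  · rintro k _ h0 h1 ⟨e, he, rfl⟩ h3 h4 ⟨e', he', h'⟩
    rw [hconst e' e he' h3 h4, he] at h'
    change c (k + 1) = _ at h'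
    apply hne
    rw [← h']
    rcases h1 with h1 | h1
    · rw [hlow (k + 1) (by omega), hlow i le_rfl]
    · exact (hhigh (k + 1) (by omega) (by omega)).symm

end RotationSystem

/-- The two sides of a closed walk through `v` with vertex set `D` whose neighbours of `v` have the
indices `i < j` in the cyclic order: `ψ` is constant along the edges avoiding `D`, it holds on
the corners at `v` between `i` and `j`, and it fails on the remaining corners. -/
structure IsSeparation {V : Type*} (G : SimpleGraph V) (v : V) (n : ℕ) (on : ℕ → V → Prop)
    (i j : ℕ) (D ψ : V → Prop) : Prop where
  adj : ∀ a b, ¬ D a → ¬ D b → G.Adj a b → (ψ a ↔ ψ b)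
  inner : ∀ k w, i ≤ k → k < j → on k w → ¬ D w → ψ w
  outer : ∀ k w, k < n → (k < i ∨ j ≤ k) → on k w → ¬ D w → ¬ ψ w

/-- The neighbourhood of a vertex `v` of degree `n` in a pentagulation of girth at least `5`:
`u 0, u 1, …` are the neighbours of `v` in cyclic order, `on k w` says that `w` lies on the face
between `u k` and `u (k + 1)`, and `K` is the adjacency relation of the faces around `v`. -/
structure IsSpokeSystem {V : Type*} (G : SimpleGraph V) (v : V) (n : ℕ) (u : ℕ → V)
    (on : ℕ → V → Prop) (K : V → V → Prop) : Prop where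
  triangle : ∀ a b c, G.Adj a b → G.Adj b c → G.Adj c a → False
  square : ∀ a b c d, G.Adj a b → G.Adj b c → G.Adj c d → G.Adj d a → a ≠ c → b = d
  adj : ∀ k, G.Adj v (u k)
  inj : ∀ k l, k < n → l < n → u k = u l → k = l
  on_left : ∀ k, on k (u k)
  corner : ∀ k, ∃ a b, G.Adj (u k) a ∧ G.Adj a b ∧ G.Adj b (u (k + 1)) ∧ on k a ∧ on k b ∧ K a b
  sep : ∀ i j, i < j → j < n → ∀ P : G.Walk (u i) (u j), v ∉ P.support →
    ∃ ψ, IsSeparation G v n on i j (fun w => w = v ∨ w ∈ P.support) ψ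

/-! ### Consequences of girth 5 and separation for spokes and their children -/

namespace IsSpokeSystem

variable {V : Type*} {G : SimpleGraph V} {v : V} {n : ℕ} {u : ℕ → V} {on : ℕ → V → Prop}
  {K : V → V → Prop}

theorem sep_four (S : IsSpokeSystem G v n u on K) {i j : ℕ} (hij : i < j) (hj : j < n) {a b : V}
    (h1 : G.Adj (u i) a) (h2 : G.Adj a b) (h3 : G.Adj b (u j)) (ha : a ≠ v) (hb : b ≠ v) :
    ∃ ψ, IsSeparation G v n on i j (fun w => w = v ∨ w = u i ∨ w = a ∨ w = b ∨ w = u j) ψ := by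
  have := S.sep i j hij hj (.cons h1 (.cons h2 (.cons h3 .nil)))
    (by simp [(S.adj i).ne, (S.adj j).ne, ha.symm, hb.symm])
  simpa using this

theorem sep_five (S : IsSpokeSystem G v n u on K) {i j : ℕ} (hij : i < j) (hj : j < n)
    {a b c : V} (h1 : G.Adj (u i) a) (h2 : G.Adj a b) (h3 : G.Adj b c) (h4 : G.Adj c (u j))
    (ha : a ≠ v) (hb : b ≠ v) (hc : c ≠ v) :
    ∃ ψ, IsSeparation G v n on i j
      (fun w => w = v ∨ w = u i ∨ w = a ∨ w = b ∨ w = c ∨ w = u j) ψ := by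
  have := S.sep i j hij hj (.cons h1 (.cons h2 (.cons h3 (.cons h4 .nil))))
    (by simp [(S.adj i).ne, (S.adj j).ne, ha.symm, hb.symm, hc.symm])
  simpa using this

/-- The endvertices of an edge of a graph of girth `5` that is disjoint from the edge `xy` cannot
both have a neighbour in `{x, y}`. -/
theorem exists_not_adj (S : IsSpokeSystem G v n u on K) {x y a b : V} (hxy : G.Adj x y)
    (hab : G.Adj a b) (hax : a ≠ x) (hay : a ≠ y) (hbx : b ≠ x) (hby : b ≠ y) :
    ∃ z, (z = a ∨ z = b) ∧ ¬ G.Adj z x ∧ ¬ G.Adj z y := by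
  by_contra! h
  have hb : ¬ G.Adj b x → G.Adj b y := h b (.inr rfl)
  by_cases h1 : G.Adj a x <;> by_cases h2 : G.Adj b x
  · exact S.triangle _ _ _ hab h2 h1.symm
  · exact hbx (S.square _ _ _ _ hab (hb h2) hxy.symm h1.symm hay)
  · exact hby (S.square _ _ _ _ hab h2 hxy (h a (.inl rfl) h1).symm hax)
  · exact S.triangle _ _ _ hab (hb h2) (h a (.inl rfl) h1).symm

theorem parent_unique (S : IsSpokeSystem G v n u on K) {k l : ℕ} {w : V} (hk : k < n) (hl : l < n)
    (h1 : G.Adj w (u k)) (h2 : G.Adj w (u l)) (hw : w ≠ v) : k = l :=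
  S.inj k l hk hl (S.square w (u k) v (u l) h1 (S.adj k).symm (S.adj l) h2.symm hw)

theorem not_adj_center (S : IsSpokeSystem G v n u on K) {k : ℕ} {w : V} (h : G.Adj w (u k)) :
    ¬ G.Adj v w := fun h' => S.triangle v w (u k) h' h (S.adj k).symm

/-- The inner vertices of a corner are different from `v`. -/
theorem corner' (S : IsSpokeSystem G v n u on K) (k : ℕ) : ∃ a b, G.Adj a (u k) ∧ G.Adj a b ∧
    G.Adj b (u (k + 1)) ∧ a ≠ v ∧ b ≠ v ∧ on k a ∧ on k b ∧ K a b := by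
  obtain ⟨a, b, h1, h2, h3, h4, h5, h6⟩ := S.corner k
  refine ⟨a, b, h1.symm, h2, h3, ?_, ?_, h4, h5, h6⟩
  · rintro rfl
    exact S.triangle _ _ _ h2 h3 (S.adj _).symm
  · rintro rfl
    exact S.triangle _ _ _ h1 h2 (S.adj _)

/-- Two vertices on different sides of a separating set `D`, one of which has no neighbour in `D`,
are at distance at most `3` only if they are joined by a path of length `3` whose second vertex
is in `D`. -/
theorem _root_.IsSeparation.exists_common {i j : ℕ} {D ψ : V → Prop}
    (h : IsSeparation G v n on i j D ψ) {w z : V} (hw : ¬ D w) (hz : ¬ D z) (hψ : ψ w) (hψ' : ¬ ψ z)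
    (hD : ∀ c, D c → ¬ G.Adj z c)
    (hd : ∃ p q, (w = p ∨ G.Adj w p) ∧ (p = q ∨ G.Adj p q) ∧ (q = z ∨ G.Adj q z)) :
    ∃ c, D c ∧ G.Adj w c ∧ ∃ s, G.Adj c s ∧ G.Adj s z := by
  obtain ⟨p, q, h1, h2, h3⟩ := hd
  have ha := h.adj
  have := fun a b => G.adj_comm a b
  grind

/-- Let `z` be a vertex that is adjacent to a neighbour `r` of `v`, and let `D` be the closed walk
`v, q, t, z, r` or `v, q, y, t, z, r`.  A vertex `z'` on the side of `D` not containing `x` that has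
distance at most `2` to `x` or to the parent `p` of `x` is adjacent to `y`. -/
theorem adj_of_separation (S : IsSpokeSystem G v n u on K) {i j : ℕ} {D ψ : V → Prop}
    (h : IsSeparation G v n on i j D ψ) {p q r r' x y z z' t c c' : V}
    (hp : G.Adj v p) (hq : G.Adj v q) (hr : G.Adj v r) (hr' : G.Adj v r')
    (hpq : p ≠ q) (hpr : p ≠ r) (hpr' : p ≠ r') (hqr : q ≠ r) (hqr' : q ≠ r') (hrr' : r ≠ r')
    (hx : G.Adj p x) (hy : G.Adj q y) (hxy : G.Adj x y) (hxv : x ≠ v) (hyv : y ≠ v)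
    (hz : G.Adj r z) (hzv : z ≠ v) (hz' : G.Adj r' z') (hzv' : z' ≠ v)
    (hzx : ¬ G.Adj z x) (hzy : ¬ G.Adj z y)
    (hc' : c' = y ∨ c' = q) (ht : G.Adj c' t) (htz : G.Adj t z)
    (hD : ∀ w, D w ↔ w = v ∨ w = q ∨ (w = y ∧ c' = y) ∨ w = t ∨ w = z ∨ w = r)
    (hψ : ¬ D r' → ¬ D p → ¬ (ψ r' ↔ ψ p)) (hc : c = x ∨ c = p)
    (h' : ¬ G.Adj z' x → ¬ G.Adj z' y → ∃ s, G.Adj c s ∧ G.Adj s z') : G.Adj z' y := by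
  by_contra hzy'
  have ha := h.adj
  have tri := S.triangle
  have sq := S.square
  have sy := fun a b => (G.adj_comm a b).mp
  have par : ∀ a b w, G.Adj v a → G.Adj v b → G.Adj a w → G.Adj b w → w ≠ v → a = b :=
    fun a b w h1 h2 h3 h4 h5 => sq w a v b h3.symm h1.symm h2 h4 h5
  have hvc : ∀ a w, G.Adj v a → G.Adj a w → ¬ G.Adj v w := fun a w h1 h2 h3 =>
    tri v a w h1 h2 h3.symm
  have hvz := hvc _ _ hr hz
  have hvz' := hvc _ _ hr' hz'
  have hvx := hvc _ _ hp hx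
  have hvy := hvc _ _ hq hy
  have htx : t ≠ x := fun e => hzx (e ▸ htz.symm)
  have hty : t ≠ y := fun e => hzy (e ▸ htz.symm)
  have htp : t ≠ p := by rintro rfl; exact hpr (par _ _ _ hp hr htz hz hzv)
  have htr' : t ≠ r' := by rintro rfl; exact hrr' (par _ _ _ hr hr' hz htz hzv)
  have hzz' : z ≠ z' := by rintro rfl; exact hrr' (par _ _ _ hr hr' hz hz' hzv)
  have hzex : z ≠ x := by rintro rfl; exact hpr (par _ _ _ hp hr hx hz hzv)
  have hzx' : z' ≠ x := by rintro rfl; exact hpr' (par _ _ _ hp hr' hx hz' hxv)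
  have hzey' : z' ≠ y := by rintro rfl; exact hqr' (par _ _ _ hq hr' hy hz' hyv)
  have htz' : t ≠ z' := by
    rintro rfl
    rcases hc' with rfl | rfl
    · exact hzy' ht.symm
    · exact hqr' (par _ _ _ hq hr' ht hz' hzv')
  have Dp : ¬ D p := by
    rw [hD]; rintro (e | e | e | e | e | e)
    · exact hp.ne' e
    · exact hpq e
    · exact hvy (e.1 ▸ hp)
    · exact htp e.symm
    · exact hvz (e ▸ hp)
    · exact hpr e
  have Dx : ¬ D x := by
    rw [hD]; rintro (e | e | e | e | e | e)
    · exact hxv e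
    · exact hvx (e ▸ hq)
    · exact hxy.ne e.1
    · exact htx e.symm
    · exact hzex e.symm
    · exact hvx (e ▸ hr)
  have Dr' : ¬ D r' := by
    rw [hD]; rintro (e | e | e | e | e | e)
    · exact hr'.ne' e
    · exact hqr' e.symm
    · exact hvy (e.1 ▸ hr')
    · exact htr' e.symm
    · exact hvz (e ▸ hr')
    · exact hrr' e.symm
  have Dz' : ¬ D z' := by
    rw [hD]; rintro (e | e | e | e | e | e)
    · exact hzv' e
    · exact hvz' (e ▸ hq)
    · exact hzey' e.1
    · exact htz' e.symm
    · exact hzz' e.symm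
    · exact hvz' (e ▸ hr)
  replace hψ := hψ Dr' Dp
  have e1 := ha _ _ Dr' Dz' hz'
  have e2 := ha _ _ Dp Dx hx
  by_cases hzx2 : G.Adj z' x
  · exact hψ (e1.trans ((ha _ _ Dz' Dx hzx2).trans e2.symm))
  obtain ⟨s, hs, hs'⟩ := h' hzx2 hzy'
  have Dc : ¬ D c ∧ (ψ c ↔ ψ p) := by
    rcases hc with rfl | rfl
    · exact ⟨Dx, e2.symm⟩
    · exact ⟨Dp, Iff.rfl⟩
  -- `z'` lies on the side of `r'` and `c` on that of `p`, so the path `c, s, z'` must meet `D` in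
  -- its middle vertex. Each position of `s` on `D` then gives a short cycle or an excluded
  -- adjacency.
  have Ds : D s := by
    by_contra Ds
    exact hψ (e1.trans ((ha _ _ Ds Dz' hs').symm.trans ((ha _ _ Dc.1 Ds hs).symm.trans Dc.2)))
  rw [hD] at Ds
  rcases Ds with rfl | rfl | ⟨rfl, -⟩ | rfl | rfl | rfl
  · exact hvz' hs'
  · exact hqr' (par _ _ _ hq hr' hs' hz' hzv')
  · exact hzy' hs'.symm
  · rcases hc with rfl | rfl <;> rcases hc' with rfl | rfl
    · exact tri _ _ _ hxy ht hs.symm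
    · exact hty (sq _ _ _ _ hs ht.symm hy hxy.symm (by rintro rfl; exact hvx hq))
    · exact htx (sq _ _ _ _ hs ht.symm hxy.symm hx.symm (by rintro rfl; exact hvy hp))
    · have : s ≠ v := by rintro rfl; exact hvz htz
      exact hpq (par _ _ _ hp hq hs ht this)
  · rcases hc with rfl | rfl
    · exact hzx hs.symm
    · exact hpr (par _ _ _ hp hr hs hz hzv)
  · rcases hc with rfl | rfl
    · exact hpr (par _ _ _ hp hr hx hs.symm hxv)
    · exact tri _ _ _ hp hs hr.symm

end IsSpokeSystem

/-! ### The two sides of a chord -/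

namespace IsSpokeSystem

variable {V : Type*} {G : SimpleGraph V} {v : V} {n : ℕ} {u : ℕ → V} {on : ℕ → V → Prop}
  {K : V → V → Prop}

section Chord

variable (S : IsSpokeSystem G v n u on K) {m : ℕ} {x y : V} (hm : m < n)
  (hx : G.Adj x (u 0)) (hy : G.Adj y (u m)) (hxv : x ≠ v) (hyv : y ≠ v) (hxy : G.Adj x y)

include S hm hx hy

theorem spoke_notMem {k : ℕ} (hk : k < n) (h0 : k ≠ 0) (hkm : k ≠ m) :
    ¬ (u k = v ∨ u k = u 0 ∨ u k = x ∨ u k = y ∨ u k = u m) := by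
  rintro (e | e | e | e | e)
  · exact (S.adj k).ne' e
  · exact h0 (S.inj _ _ hk (by omega) e)
  · exact S.not_adj_center hx (e ▸ S.adj k)
  · exact S.not_adj_center hy (e ▸ S.adj k)
  · exact hkm (S.inj _ _ hk hm e)

theorem child_notMem {k : ℕ} {z : V} (hk : k < n) (h0 : k ≠ 0) (hkm : k ≠ m)
    (hz : G.Adj z (u k)) (hzv : z ≠ v) :
    ¬ (z = v ∨ z = u 0 ∨ z = x ∨ z = y ∨ z = u m) := by
  rintro (e | e | e | e | e)
  · exact hzv e
  · exact S.not_adj_center hz (e ▸ S.adj 0)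
  · exact h0 (S.parent_unique hk (by omega) hz (e ▸ hx) hzv)
  · exact hkm (S.parent_unique hk hm hz (e ▸ hy) hzv)
  · exact S.not_adj_center hz (e ▸ S.adj m)

omit hx hy in
theorem child_not_adj {k : ℕ} {z : V} (hk : k < n) (h0 : k ≠ 0) (hkm : k ≠ m)
    (hz : G.Adj z (u k)) (hzv : z ≠ v) (hzx : ¬ G.Adj z x) (hzy : ¬ G.Adj z y) (c : V)
    (hc : c = v ∨ c = u 0 ∨ c = x ∨ c = y ∨ c = u m) : ¬ G.Adj z c := by
  rintro h
  rcases hc with rfl | rfl | rfl | rfl | rfl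
  · exact S.not_adj_center hz h.symm
  · exact h0 (S.parent_unique hk (by omega) hz h hzv)
  · exact hzx h
  · exact hzy h
  · exact hkm (S.parent_unique hk hm hz h hzv)

include hxy

/-- The corner between the two spokes supplies adjacent children, and `exists_not_adj` applies to
the edge joining them. -/
theorem exists_child_not_adj {k : ℕ} (hk : k + 1 < n) (h0 : k ≠ 0) (hkm : k ≠ m)
    (hkm' : k + 1 ≠ m) : ∃ l z, (l = k ∨ l = k + 1) ∧ G.Adj z (u l) ∧ z ≠ v ∧
      ¬ G.Adj z x ∧ ¬ G.Adj z y := by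
  obtain ⟨a, b, ha, hab, hb, hav, hbv, -⟩ := S.corner' k
  have ha' := S.child_notMem hm hx hy (by omega) h0 hkm ha hav
  have hb' := S.child_notMem hm hx hy hk (by omega) hkm' hb hbv
  push Not at ha' hb'
  obtain ⟨z, rfl | rfl, h1, h2⟩ := S.exists_not_adj hxy hab ha'.2.2.1 ha'.2.2.2.1 hb'.2.2.1
    hb'.2.2.2.1
  · exact ⟨k, z, .inl rfl, ha, hav, h1, h2⟩
  · exact ⟨k + 1, z, .inr rfl, hb, hbv, h1, h2⟩

omit hxy in
-- The child `z` lies outside the 5-cycle together with its spoke and has no neighbour on the cycle,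
-- so a shortest path from an inner vertex `w` must enter the cycle at its second vertex.
theorem exists_common_of_child {ψ : V → Prop}
    (hψ : IsSeparation G v n on 0 m (fun w => w = v ∨ w = u 0 ∨ w = x ∨ w = y ∨ w = u m) ψ)
    (hd : ∀ w z, ∃ p q, (w = p ∨ G.Adj w p) ∧ (p = q ∨ G.Adj p q) ∧ (q = z ∨ G.Adj q z))
    {w : V} (hw : ¬ (w = v ∨ w = u 0 ∨ w = x ∨ w = y ∨ w = u m)) (hψw : ψ w)
    {k : ℕ} {z : V} (hk : k < n) (h0 : k ≠ 0) (hkm : m < k)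
    (hz : G.Adj z (u k)) (hzv : z ≠ v) (hzx : ¬ G.Adj z x) (hzy : ¬ G.Adj z y) :
    ∃ c, (c = v ∨ c = u 0 ∨ c = x ∨ c = y ∨ c = u m) ∧ G.Adj w c ∧
      ∃ s, G.Adj c s ∧ G.Adj s z := by
  have hz' := S.child_notMem hm hx hy hk h0 hkm.ne' hz hzv
  have hk' := S.spoke_notMem hm hx hy hk h0 hkm.ne'
  refine hψ.exists_common hw hz' hψw (fun h => ?_)
    (S.child_not_adj hm hk h0 hkm.ne' hz hzv hzx hzy) (hd w z)
  exact hψ.outer k (u k) hk (.inr hkm.le) (S.on_left k) hk' ((hψ.adj _ _ hz' hk' hz).mp h)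

include hxv hyv

/-- A chord has at most one neighbour of `v` on one of its sides. -/
theorem le_two_or_of_chord (hm0 : 0 < m)
    (hd : ∀ w z, ∃ p q, (w = p ∨ G.Adj w p) ∧ (p = q ∨ G.Adj p q) ∧ (q = z ∨ G.Adj q z)) :
    m ≤ 2 ∨ n ≤ m + 2 := by
  by_contra! hc
  obtain ⟨ψ, hψ⟩ := S.sep_four hm0 hm hx.symm hxy hy hxv hyv
  -- Two spokes on each side yield `w` inside and `z` outside, both without neighbours on the
  -- 5-cycle, hence at distance more than 3.
  obtain ⟨k, w, hk, hw, hwv, hwx, hwy⟩ := S.exists_child_not_adj hm hx hy hxy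
    (k := 1) (by omega) (by omega) (by omega) (by omega)
  obtain ⟨l, z, hl, hz, hzv, hzx, hzy⟩ := S.exists_child_not_adj hm hx hy hxy
    (k := m + 1) (by omega) (by omega) (by omega) (by omega)
  have hw' := S.child_notMem hm hx hy (by omega) (by omega) (by omega) hw hwv
  have hk' := S.spoke_notMem (k := k) hm hx hy (by omega) (by omega) (by omega)
  obtain ⟨c, hcC, hwc, -⟩ := S.exists_common_of_child hm hx hy hψ hd hw'
    ((hψ.adj _ _ hw' hk' hw).mpr (hψ.inner k _ (by omega) (by omega) (S.on_left k) hk'))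
    (k := l) (by omega) (by omega) (by omega) hz hzv hzx hzy
  exact S.child_not_adj hm (by omega) (by omega) (by omega) hw hwv hwx hwy c hcC hwc

/-- If a side of a chord contains at most one neighbour of `v`, then the vertices at distance `2`
from `v` on the other side are at distance at most `2` from both sides of the chord. -/
theorem exists_ends_of_chord (hn : m + 3 ≤ n) (hm0 : 0 < m) (hm2 : m ≤ 2)
    (hK : ¬ K x y)
    (hd : ∀ w z, ∃ p q, (w = p ∨ G.Adj w p) ∧ (p = q ∨ G.Adj p q) ∧ (q = z ∨ G.Adj q z)) :
    ∃ c c', (c = x ∨ c = u 0) ∧ (c' = y ∨ c' = u m) ∧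
      ∀ k z, m < k → k < n → G.Adj z (u k) → z ≠ v → ¬ G.Adj z x → ¬ G.Adj z y →
        (∃ s, G.Adj c s ∧ G.Adj s z) ∧ ∃ s, G.Adj c' s ∧ G.Adj s z := by
  obtain ⟨ψ, hψ⟩ := S.sep_four hm0 hm hx.symm hxy hy hxv hyv
  have tri := S.triangle
  have sq := S.square
  have hvx := S.not_adj_center hx
  have hvy := S.not_adj_center hy
  have h0m : u 0 ≠ u m := fun e => hm0.ne (S.inj _ _ (by omega) hm e)
  -- If `c` is the only neighbour of the inner vertex `w` on the cycle, then every short path from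
  -- `w` to `z` runs through `c`.
  have key (w c : V) (hw : ¬ (w = v ∨ w = u 0 ∨ w = x ∨ w = y ∨ w = u m)) (hψw : ψ w)
      (hc : ∀ c', (c' = v ∨ c' = u 0 ∨ c' = x ∨ c' = y ∨ c' = u m) → G.Adj w c' → c' = c)
      (k : ℕ) (z : V) (hk : m < k) (hk' : k < n) (hz : G.Adj z (u k)) (hzv : z ≠ v)
      (hzx : ¬ G.Adj z x) (hzy : ¬ G.Adj z y) : ∃ s, G.Adj c s ∧ G.Adj s z := by
    obtain ⟨c', h1, h2, h3⟩ := S.exists_common_of_child hm hx hy hψ hd hw hψw hk'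
      (by omega) hk hz hzv hzx hzy
    rwa [← hc c' h1 h2]
  -- a vertex outside the cycle is adjacent to at most one vertex of it
  have uniq (w c : V) (hw : ¬ (w = v ∨ w = u 0 ∨ w = x ∨ w = y ∨ w = u m))
      (hc : c = v ∨ c = u 0 ∨ c = x ∨ c = y ∨ c = u m) (hwc : G.Adj w c)
      (c' : V) (hc' : c' = v ∨ c' = u 0 ∨ c' = x ∨ c' = y ∨ c' = u m) (hwc' : G.Adj w c') :
      c' = c := by
    push Not at hw
    obtain ⟨w1, w2, w3, w4, w5⟩ := hw
    have a0 := S.adj 0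
    have am := S.adj m
    have t (a b : V) (h : G.Adj a b) (ha : G.Adj w a) (hb : G.Adj w b) : False :=
      tri w a b ha h hb.symm
    have q (a b e : V) (h : G.Adj a b) (h' : G.Adj b e) (hae : a ≠ e) (ha : G.Adj w a)
        (he : G.Adj w e) : w = b := (sq a b e w h h' he.symm ha hae).symm
    have e1 : u 0 ≠ y := by rintro e; exact hvy (e ▸ a0)
    have e2 : u m ≠ x := by rintro e; exact hvx (e ▸ am)
    -- Two distinct vertices of a 5-cycle are adjacent or have a common neighbour on it; a second
    -- attachment would close a triangle or a 4-cycle.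
    rcases hc with rfl | rfl | rfl | rfl | rfl <;>
      rcases hc' with rfl | rfl | rfl | rfl | rfl <;> first
        | rfl
        | exact (t _ _ a0 ‹_› ‹_›).elim
        | exact (t _ _ am ‹_› ‹_›).elim
        | exact (t _ _ hx ‹_› ‹_›).elim
        | exact (t _ _ hy ‹_› ‹_›).elim
        | exact (t _ _ hxy ‹_› ‹_›).elim
        | exact (w2 (q _ _ _ a0 hx.symm hxv.symm ‹_› ‹_›)).elim
        | exact (w5 (q _ _ _ am hy.symm hyv.symm ‹_› ‹_›)).elim
        | exact (w1 (q _ _ _ a0.symm am h0m ‹_› ‹_›)).elim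
        | exact (w3 (q _ _ _ hx.symm hxy e1 ‹_› ‹_›)).elim
        | exact (w4 (q _ _ _ hy.symm hxy.symm e2 ‹_› ‹_›)).elim
  have main (w w' c c' : V) (hc : c = x ∨ c = u 0) (hc' : c' = y ∨ c' = u m)
      (hw : ¬ (w = v ∨ w = u 0 ∨ w = x ∨ w = y ∨ w = u m)) (hψw : ψ w) (hwc : G.Adj w c)
      (hw' : ¬ (w' = v ∨ w' = u 0 ∨ w' = x ∨ w' = y ∨ w' = u m)) (hψw' : ψ w')
      (hwc' : G.Adj w' c') : ∃ c c', (c = x ∨ c = u 0) ∧ (c' = y ∨ c' = u m) ∧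
      ∀ k z, m < k → k < n → G.Adj z (u k) → z ≠ v → ¬ G.Adj z x → ¬ G.Adj z y →
        (∃ s, G.Adj c s ∧ G.Adj s z) ∧ ∃ s, G.Adj c' s ∧ G.Adj s z :=
    ⟨c, c', hc, hc', fun k z h1 h2 h3 h4 h5 h6 =>
      ⟨key w c hw hψw (uniq w c hw (by tauto) hwc) k z h1 h2 h3 h4 h5 h6,
        key w' c' hw' hψw' (uniq w' c' hw' (by tauto) hwc') k z h1 h2 h3 h4 h5 h6⟩⟩
  obtain ⟨a, b, ha, hab, hb, hav, hbv, oa, ob, hKab⟩ := S.corner' 0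
  -- an end of the first corner that is not on the cycle
  have hau : a ≠ u 0 := ha.ne
  have ham : a ≠ u m := fun e => S.not_adj_center ha (e ▸ S.adj m)
  have hay : a ≠ y := by
    rintro rfl
    exact hm0.ne (S.parent_unique (by omega) hm ha hy hyv)
  interval_cases m
  -- No spoke lies inside. Since `xy` is not an edge of a face at `v`, the corner path `u 0, a, b, u
  -- 1` avoids `x` and `y`, so `a` and `b` serve for `c = u 0` and `c' = u 1`.
  · have hbx : b ≠ x := by
      rintro rfl
      exact one_ne_zero (S.parent_unique (k := 1) (by omega) (by omega) hb hx hxv)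
    have hax : a ≠ x := by
      rintro rfl
      have : b = y := sq a b (u 1) y hab hb hy.symm hxy.symm ham
      exact hK (this ▸ hKab)
    have hby : b ≠ y := by
      rintro rfl
      have : a = x := sq b a (u 0) x hab.symm ha hx.symm hxy
        fun e => S.not_adj_center hb (e ▸ S.adj 0)
      exact hax this
    have hbu : b ≠ u 0 := fun e => S.not_adj_center hb (e ▸ S.adj 0)
    have ha' : ¬ (a = v ∨ a = u 0 ∨ a = x ∨ a = y ∨ a = u 1) := by tauto
    have hb' : ¬ (b = v ∨ b = u 0 ∨ b = x ∨ b = y ∨ b = u 1) := by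
      have := hb.ne; tauto
    exact main a b (u 0) (u 1) (.inr rfl) (.inr rfl) ha' (hψ.inner 0 a le_rfl one_pos oa ha') ha
      hb' (hψ.inner 0 b le_rfl one_pos ob hb') hb
  · obtain ⟨a', b', h1, h2, h3, h4, h5, h6, h7, -⟩ := S.corner' 1
    obtain ⟨k, z, hk, hz, hzv, hzx, hzy⟩ := S.exists_child_not_adj hm hx hy hxy
      (k := 3) (by omega) (by omega) (by omega) (by omega)
    -- Every child of the single inner spoke `u 1` is adjacent to `x` or `y`; otherwise it would be
    -- too far from the outer child `z`.
    have inner (w : V) (hw : G.Adj w (u 1)) (hwv : w ≠ v) :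
        ¬ (w = v ∨ w = u 0 ∨ w = x ∨ w = y ∨ w = u 2) ∧ ψ w ∧ (G.Adj w x ∨ G.Adj w y) := by
      have hw' := S.child_notMem hm hx hy (k := 1) (by omega) one_ne_zero (by omega) hw hwv
      have h1' := S.spoke_notMem hm hx hy (k := 1) (by omega) one_ne_zero (by omega)
      have hψw : ψ w := (hψ.adj _ _ hw' h1' hw).mpr
        (hψ.inner 1 _ (by omega) (by omega) (S.on_left 1) h1')
      refine ⟨hw', hψw, ?_⟩
      by_contra! hwn
      obtain ⟨c, hcC, hwc, -⟩ := S.exists_common_of_child hm hx hy hψ hd hw' hψw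
        (k := k) (by omega) (by omega) (by omega) hz hzv hzx hzy
      exact S.child_not_adj hm (by omega) (by omega) (by omega) hw hwv hwn.1 hwn.2 c hcC hwc
    obtain ⟨b1, b2, b3⟩ := inner b hb hbv
    obtain ⟨a1, a2, a3⟩ := inner a' h1 h4
    -- The children `b`, `a'` of `u 1` come from the corners before and after it. If `b` sees `y`,
    -- pair it with `a` at `u 0`. Otherwise `b` sees `x` and is paired with `a'` if that sees `y`,
    -- else with `b'` at `u 2`.
    by_cases hby : G.Adj b y
    · have hax : a ≠ x := by
        rintro rfl
        exact tri _ _ _ hab hby hxy.symm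
      have ha' : ¬ (a = v ∨ a = u 0 ∨ a = x ∨ a = y ∨ a = u 2) := by tauto
      exact main a b (u 0) y (.inr rfl) (.inl rfl) ha' (hψ.inner 0 a le_rfl two_pos oa ha') ha
        b1 b2 hby
    · have hbx : G.Adj b x := b3.resolve_right hby
      by_cases hay' : G.Adj a' y
      · exact main b a' x y (.inl rfl) (.inl rfl) b1 b2 hbx a1 a2 hay'
      · have hax' : G.Adj a' x := a3.resolve_right hay'
        have hby' : b' ≠ y := by
          rintro rfl
          exact tri _ _ _ h2 hxy.symm hax'.symm
        have hbx' : b' ≠ x := by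
          rintro rfl
          exact two_ne_zero (S.parent_unique (k := 2) (by omega) (by omega) h3 hx hxv)
        have hbu' : b' ≠ u 0 := fun e => S.not_adj_center h3 (e ▸ S.adj 0)
        have hb' : ¬ (b' = v ∨ b' = u 0 ∨ b' = x ∨ b' = y ∨ b' = u 2) := by
          have := h3.ne; tauto
        exact main b b' x (u 2) (.inl rfl) (.inr rfl) b1 b2 hbx hb'
          (hψ.inner 1 b' (by omega) (by omega) h7 hb') h3

/-- The paths of length 2 from `c` and `c'` to one outer child `z` of `u k` split the large side.
Too many children on one part are then adjacent to the same end of the chord. -/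
theorem false_of_chord (hn : 8 ≤ n) (hm0 : 0 < m) (hm2 : m ≤ 2) (hK : ¬ K x y)
    (hd : ∀ w z, ∃ p q, (w = p ∨ G.Adj w p) ∧ (p = q ∨ G.Adj p q) ∧ (q = z ∨ G.Adj q z)) :
    False := by
  obtain ⟨c, c', hc, hc', H⟩ := S.exists_ends_of_chord hm hx hy hxv hyv hxy (by omega) hm0 hm2
    hK hd
  obtain ⟨k, z, hk, hz, hzv, hzx, hzy⟩ := S.exists_child_not_adj hm hx hy hxy
    (k := m + 1) (by omega) (by omega) (by omega) (by omega)
  replace hk : m < k ∧ k < n := by omega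
  have hne {i j : ℕ} (hi : i < n) (hj : j < n) (hij : i ≠ j) : u i ≠ u j :=
    fun e => hij (S.inj i j hi hj e)
  obtain ⟨⟨s, hs, hsz⟩, ⟨t, ht, htz⟩⟩ := H k z hk.1 hk.2 hz hzv hzx hzy
  have hvz := S.not_adj_center hz
  have hsv : s ≠ v := by rintro rfl; exact hvz hsz
  have htv : t ≠ v := by rintro rfl; exact hvz htz
  -- The walk `v, u m, t, z, u k`, passing through `y` as well when `c' = y`, separates `u l` from
  -- `u 0`. A path of length 2 from `c` to `z'` would have to cross it.
  have right (l : ℕ) (z' : V) (hl : m < l) (hlk : l < k) (h1 : G.Adj z' (u l)) (h2 : z' ≠ v) :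
      G.Adj z' y := by
    obtain ⟨D, ψ, hψ, hD⟩ : ∃ D ψ, IsSeparation G v n on m k D ψ ∧ ∀ w, D w ↔
        w = v ∨ w = u m ∨ (w = y ∧ c' = y) ∨ w = t ∨ w = z ∨ w = u k := by
      by_cases hcy : c' = y
      · subst hcy
        obtain ⟨ψ, hψ⟩ := S.sep_five hk.1 hk.2 hy.symm ht htz hz hyv htv hzv
        exact ⟨_, ψ, hψ, fun w => by simp⟩
      · obtain rfl := hc'.resolve_left hcy
        obtain ⟨ψ, hψ⟩ := S.sep_four hk.1 hk.2 ht htz hz htv hzv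
        exact ⟨_, ψ, hψ, fun w => by simp [hcy]⟩
    refine S.adj_of_separation hψ (S.adj 0) (S.adj m) (S.adj k) (S.adj l)
      (hne (by omega) (by omega) (by omega)) (hne (by omega) (by omega) (by omega))
      (hne (by omega) (by omega) (by omega)) (hne (by omega) (by omega) (by omega))
      (hne (by omega) (by omega) (by omega)) (hne (by omega) (by omega) (by omega))
      hx.symm hy.symm hxy hxv hyv hz.symm hzv h1.symm h2 hzx hzy hc' ht htz hD (fun Dl D0 e => ?_) hc
      (fun h3 h4 => (H l z' hl (by omega) h1 h2 h3 h4).1)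
    exact hψ.outer 0 _ (by omega) (.inl hm0) (S.on_left 0) D0
      (e.mp (hψ.inner l _ hl.le hlk (S.on_left l) Dl))
  -- The mirror image, with the roles of `x` and `y` exchanged and the walk running through `s`.
  have left (l : ℕ) (z' : V) (hl : k < l) (hln : l < n) (h1 : G.Adj z' (u l)) (h2 : z' ≠ v) :
      G.Adj z' x := by
    obtain ⟨D, ψ, hψ, hD⟩ : ∃ D ψ, IsSeparation G v n on 0 k D ψ ∧ ∀ w, D w ↔
        w = v ∨ w = u 0 ∨ (w = x ∧ c = x) ∨ w = s ∨ w = z ∨ w = u k := by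
      by_cases hcx : c = x
      · subst hcx
        obtain ⟨ψ, hψ⟩ := S.sep_five (by omega) hk.2 hx.symm hs hsz hz hxv hsv hzv
        exact ⟨_, ψ, hψ, fun w => by simp⟩
      · obtain rfl := hc.resolve_left hcx
        obtain ⟨ψ, hψ⟩ := S.sep_four (by omega) hk.2 hs hsz hz hsv hzv
        exact ⟨_, ψ, hψ, fun w => by simp [hcx]⟩
    refine S.adj_of_separation hψ (S.adj m) (S.adj 0) (S.adj k) (S.adj l)
      (hne (by omega) (by omega) (by omega)) (hne (by omega) (by omega) (by omega))
      (hne (by omega) (by omega) (by omega)) (hne (by omega) (by omega) (by omega))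
      (hne (by omega) (by omega) (by omega)) (hne (by omega) (by omega) (by omega))
      hy.symm hx.symm hxy.symm hyv hxv hz.symm hzv h1.symm h2 hzy hzx hc hs hsz hD (fun Dl Dm e => ?_) hc'
      (fun h3 h4 => (H l z' (by omega) (by omega) h1 h2 h4 h3).2)
    exact hψ.outer l _ hln (.inr hl.le) (S.on_left l) Dl
      (e.mpr (hψ.inner m _ m.zero_le hk.1 (S.on_left m) Dm))
  -- Either spokes `k - 2` and `k - 1` lie strictly between `m` and `k`, or spokes `k + 1` and `k +
  -- 2` come before the wrap-around at `n`. If the latter fails, then `k ≥ 6`, while `m ≤ 2`.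
  have h8 : (m < k - 2 ∧ k - 2 + 1 < k) ∨ k + 2 < n := by omega
  rcases h8 with h8 | h8
  · obtain ⟨a, b, ha, hab, hb, hav, hbv, -⟩ := S.corner' (k - 2)
    exact S.triangle _ _ _ hab (right _ b (by omega) (by omega) hb hbv)
      (right _ a (by omega) (by omega) ha hav).symm
  · obtain ⟨a, b, ha, hab, hb, hav, hbv, -⟩ := S.corner' (k + 1)
    exact S.triangle _ _ _ hab (left _ b (by omega) (by omega) hb hbv)
      (left _ a (by omega) (by omega) ha hav).symm

end Chord

end IsSpokeSystem

/-! ### Girth and distance as short paths, and the conclusion -/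

namespace SimpleGraph

variable {V : Type*} {G : SimpleGraph V}

theorem not_triangle_of_girth (hg : 3 < G.girth) (a b c : V) (h1 : G.Adj a b) (h2 : G.Adj b c)
    (h3 : G.Adj c a) : False := by
  have hc : (Walk.cons h1 (Walk.cons h2 (Walk.cons h3 Walk.nil))).IsCycle := by
    simp [Walk.cons_isCycle_iff, h1.ne, h1.ne', h2.ne, h3.ne, h3.ne']
  have := girth_le_length hc
  simp only [Walk.length_cons, Walk.length_nil] at this
  omega

theorem eq_of_square_of_girth (hg : 4 < G.girth) (a b c d : V) (h1 : G.Adj a b) (h2 : G.Adj b c)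
    (h3 : G.Adj c d) (h4 : G.Adj d a) (hac : a ≠ c) : b = d := by
  by_contra hbd
  have hc : (Walk.cons h1 (Walk.cons h2 (Walk.cons h3 (Walk.cons h4 Walk.nil)))).IsCycle := by
    simp [Walk.cons_isCycle_iff, h1.ne, h1.ne', h2.ne, h3.ne, h4.ne, h4.ne', hac, hac.symm,
      hbd]
  have := girth_le_length hc
  simp only [Walk.length_cons, Walk.length_nil] at this
  omega

theorem exists_of_dist_le_three (hG : G.Connected) {w z : V} (h : G.dist w z ≤ 3) :
    ∃ p q, (w = p ∨ G.Adj w p) ∧ (p = q ∨ G.Adj p q) ∧ (q = z ∨ G.Adj q z) := by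
  obtain ⟨p, hp⟩ := hG.exists_walk_length_eq_dist w z
  rw [← hp] at h
  match p, h with
  | .nil, _ => exact ⟨w, w, .inl rfl, .inl rfl, .inl rfl⟩
  | .cons h1 .nil, _ => exact ⟨_, _, .inr h1, .inl rfl, .inl rfl⟩
  | .cons h1 (.cons h2 .nil), _ => exact ⟨_, _, .inr h1, .inr h2, .inl rfl⟩
  | .cons h1 (.cons h2 (.cons h3 .nil)), _ => exact ⟨_, _, .inr h1, .inr h2, .inr h3⟩
  | .cons h1 (.cons h2 (.cons h3 (.cons h4 p))), h =>
    simp only [Walk.length_cons] at h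
    omega

theorem exists_common_of_dist_eq_two (hG : G.Connected) {v w : V} (h : G.dist v w = 2) :
    ∃ p, G.Adj v p ∧ G.Adj w p := by
  obtain ⟨p, hp⟩ := hG.exists_walk_length_eq_dist v w
  rw [h] at hp
  match p, hp with
  | .cons h1 (.cons h2 .nil), _ => exact ⟨_, h1, h2.symm⟩

end SimpleGraph

theorem RotationSystem.isSpokeSystem {V : Type*} [Fintype V] {G : SimpleGraph V}
    [DecidableRel G.Adj] (M : RotationSystem G) (hM : M.IsPentagulation) (hg : 4 < G.girth)
    (d : G.Dart) :
    IsSpokeSystem G d.fst (G.degree d.fst) (fun k => ((M.rot ^ k) d).snd)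
      (fun k => M.VertexOnFace (M.faceOf ((M.rot ^ (k + 1)) d))) (M.facesAround d.fst).Adj where
  triangle := SimpleGraph.not_triangle_of_girth (by omega)
  square := SimpleGraph.eq_of_square_of_girth hg
  adj := M.adj_rot_pow_snd d
  inj _ _ hk hl h := M.rot_pow_snd_inj d hk hl h
  on_left k := by
    rw [M.rot_pow_succ]
    exact M.vertexOnFace_rot_snd _
  corner k := by
    obtain ⟨a, b, h1, h2, h3, h4, h5, h6⟩ := M.exists_pentagon hM.2 ((M.rot ^ k) d)
    rw [M.rot_pow_fst] at h6
    rw [M.rot_pow_succ]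
    exact ⟨a, b, h1, h2, h3, h4, h5, h6⟩
  sep i j hij hj P hP := by
    obtain ⟨ψ, h1, h2, h3⟩ := M.exists_separation hM.1 d hij hj P hP
    refine ⟨ψ, fun a b ha hb h => ?_, fun k w hk hk' ho hw => ?_, fun k w hk hk' ho hw => ?_⟩
    · push Not at ha hb
      exact h1 a b ha.1 hb.1 ha.2 hb.2 h
    · push Not at hw
      exact h2 k w hk hk' ho hw.1 hw.2
    · push Not at hw
      exact h3 k w hk hk' ho hw.1 hw.2

theorem mainTheorem9 {V : Type*} [Fintype V] (G : SimpleGraph V) [DecidableRel G.Adj]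
    (M : RotationSystem G) (hM : M.IsPentagulation) (hdiam : G.diam = 3) (hgirth : G.girth = 5)
    (v : V) (hv : G.degree v = G.maxDegree) (hΔ : 8 ≤ G.maxDegree) :
    ¬ ∃ (x y : V) (Q : G.Walk x y), M.IsChord v 1 Q := by
  rintro ⟨x, y, Q, hx, hy, -, hQ, -, hK⟩
  have hG := hM.1.1
  have hxy : G.Adj x y := SimpleGraph.Walk.adj_of_length_eq_one hQ
  replace hK : ¬ (M.facesAround v).Adj x y := by
    match Q, hQ with
    | .cons h .nil, _ => exact hK s(x, y) (by simp)
  have hd (w z : V) := SimpleGraph.exists_of_dist_le_three hG (w := w) (z := z) <| by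
    rw [← hdiam]
    -- An infinite extended diameter would give `diam` the default value 0, not 3.
    exact SimpleGraph.dist_le_diam fun h => by simp [SimpleGraph.diam, h] at hdiam
  have ne_of_dist {w : V} (h : G.dist v w = 2) : w ≠ v := by
    rintro rfl
    simp at h
  have hxv := ne_of_dist hx
  have hyv := ne_of_dist hy
  obtain ⟨p, hvp, hxp⟩ := SimpleGraph.exists_common_of_dist_eq_two hG hx
  obtain ⟨q, hvq, hyq⟩ := SimpleGraph.exists_common_of_dist_eq_two hG hy
  have S := M.isSpokeSystem hM (by omega) ⟨(v, p), hvp⟩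
  obtain ⟨m, hm, rfl⟩ := M.exists_rot_pow_snd ⟨(v, p), hvp⟩ hvq
  have hn : 8 ≤ G.degree v := by omega
  have hm0 : 0 < m := by
    rw [pos_iff_ne_zero]
    rintro rfl
    exact S.triangle _ _ _ hxy hyq hxp.symm
  rcases S.le_two_or_of_chord hm hxp hyq hxv hyv hxy hm0 hd with h | h
  · exact S.false_of_chord hm hxp hyq hxv hyv hxy hn hm0 h hK hd
  -- The small side is the other one: renumber the spokes from the parent of `y`, so that the parent
  -- of `x` gets index `n - m ≤ 2` and the ends of the chord swap roles.
  · have S' := M.isSpokeSystem hM (by omega) ((M.rot ^ m) ⟨(v, p), hvp⟩)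
    rw [M.rot_pow_fst] at S'
    change m < G.degree v at hm
    change G.degree v ≤ m + 2 at h
    refine S'.false_of_chord (m := G.degree v - m) (Nat.sub_lt (by omega) hm0) hyq ?_ hyv hxv
      hxy.symm hn (by omega) (Nat.sub_le_iff_le_add'.mpr h) (fun h => hK h.symm) hd
    rw [← Equiv.Perm.mul_apply, ← pow_add, Nat.sub_add_cancel hm.le]
    have := M.rot_pow_degree ⟨(v, p), hvp⟩
    change (M.rot ^ G.degree v) _ = _ at this
    rw [this]
    exact hxp
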